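/- A \emph{Brouwer--Zadeh lattice} (BZ-lattice) is an algebra $(L,\wedge,\vee,{}',{}^{\sim},0,1)$ such that $(L,\wedge,\vee,0,1)$ is a bounded lattice, ${}'$ is an order-reversing operation with $a''=a$ and $a\wedge a'\le b\vee b'$ for all $a,b$, and ${}^{\sim}$ is an order-reversing operation with $a\wedge a^{\sim}=0$ and $a\le a^{\sim\sim}=a^{\sim\prime}$ for all $a$. For a class $\mathbb{C}$ of BZ-lattices, $V(\mathbb{C})=\mathrm{HSP}(\mathbb{C})$ denotes the variety of BZ-lattices generated by $\mathbb{C}$. For varieties $\mathbb{V},\mathbb{W}$ of BZ-lattices, $\mathbb{V}\vee\mathbb{W}=V(\mathbb{V}\cup\mathbb{W})$ denotes their join, and $\mathbb{V}\times_s\mathbb{W}$ denotes the class of all isomorphic images of subdirect products of a member of $\mathbb{V}$ and a member of $\mathbb{W}$. A \emph{PBZ$^*$-lattice} is a BZ-lattice that is paraorthomodular (if $a\le b$ and $a'\wedge b=0$, then $a=b$) and satisfies $(x\wedge x')^{\sim}\approx x^{\sim}\vee x'^{\sim}$. Let $\mathbb{OML}$ be the class of orthomodular lattices (that is, $a\le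 b$ implies $b=(b\wedge a')\vee a$), regarded as BZ-lattices by setting $a^{\sim}=a'$. Let $\mathbb{AOL}$ be the class of \emph{antiortholattices}, i.e. the PBZ$^*$-lattices in which $\{x: x\vee x'=1\}=\{0,1\}$. Let $\mathbb{SDM}$ be the class of PBZ$^*$-lattices satisfying $(x\wedge y)^{\sim}\approx x^{\sim}\vee y^{\sim}$, and let $\mathbb{SAOL}=\mathbb{SDM}\cap V(\mathbb{AOL})$. Let $\mathbf{D}_3$ be the three-element chain $0<c<1$ with $0'=1$, $c'=c$, $1'=0$, $0^{\sim}=1$ and $c^{\sim}=1^{\sim}=0$. Then: (i) $\mathbb{OML}\vee\mathbb{SAOL}=\mathbb{OML}\times_s\mathbb{SAOL}$ and $\mathbb{OML}\vee V(\mathbf{D}_3)=\mathbb{OML}\times_s V(\mathbf{D}_3)$; (ii) $\mathbb{OML}\vee V(\mathbf{D}_3)\subsetneq\mathbb{OML}\vee\mathbb{SAOL}\subsetneq\mathbb{OML}\vee V(\mathbb{AOL})$. -/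

import Mathlib

universe u v

namespace PBZ

/-- Brouwer--Zadeh lattices: algebras `(α, ⊓, ⊔, ', ~, ⊥, ⊤)` of type `(2,2,1,1,0,0)`.  Here `kc` is
the Kleene complement `'` and `bc` is the Brouwer complement `~`; the first three axioms on `kc` say
that the reduct without `~` is a pseudo-Kleene algebra. -/
class BZLattice (α : Type u) extends Lattice α, BoundedOrder α where
  /-- Kleene complement `a ↦ a'` -/
  kc : α → α
  /-- Brouwer complement `a ↦ a~` -/
  bc : α → α
  kc_antitone : ∀ a b : α, a ≤ b → kc b ≤ kc a
  kc_kc : ∀ a : α, kc (kc a) = a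
  inf_kc_le_sup_kc : ∀ a b : α, a ⊓ kc a ≤ b ⊔ kc b
  bc_antitone : ∀ a b : α, a ≤ b → bc b ≤ bc a
  inf_bc : ∀ a : α, a ⊓ bc a = ⊥
  le_bc_bc : ∀ a : α, a ≤ bc (bc a)
  bc_bc : ∀ a : α, bc (bc a) = kc (bc a)

/-- Homomorphisms of BZ-lattices (preserving all six operations). -/
structure BZHom (α : Type u) (β : Type v) [BZLattice α] [BZLattice β] extends
    BoundedLatticeHom α β where
  map_kc' : ∀ a : α, toFun (BZLattice.kc a) = BZLattice.kc (toFun a)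
  map_bc' : ∀ a : α, toFun (BZLattice.bc a) = BZLattice.bc (toFun a)

/-- The direct product of a family of BZ-lattices, with componentwise operations. -/
instance instBZLatticePi {ι : Type v} (F : ι → Type u) [∀ i, BZLattice (F i)] :
    BZLattice (∀ i, F i) where
  kc a := fun i => BZLattice.kc (a i)
  bc a := fun i => BZLattice.bc (a i)
  kc_antitone _ _ h := fun i => BZLattice.kc_antitone _ _ (h i)
  kc_kc _ := funext fun _ => BZLattice.kc_kc _
  inf_kc_le_sup_kc a b := fun i => BZLattice.inf_kc_le_sup_kc (a i) (b i)
  bc_antitone _ _ h := fun i => BZLattice.bc_antitone _ _ (h i)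
  inf_bc a := funext fun i => BZLattice.inf_bc (a i)
  le_bc_bc a := fun i => BZLattice.le_bc_bc (a i)
  bc_bc a := funext fun i => BZLattice.bc_bc (a i)

/-- The direct product of two BZ-lattices, with componentwise operations. -/
instance instBZLatticeProd (α : Type u) (β : Type v) [BZLattice α] [BZLattice β] :
    BZLattice (α × β) where
  kc a := (BZLattice.kc a.1, BZLattice.kc a.2)
  bc a := (BZLattice.bc a.1, BZLattice.bc a.2)
  kc_antitone _ _ h := ⟨BZLattice.kc_antitone _ _ h.1, BZLattice.kc_antitone _ _ h.2⟩
  kc_kc _ := Prod.ext (BZLattice.kc_kc _) (BZLattice.kc_kc _)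
  inf_kc_le_sup_kc a b :=
    ⟨BZLattice.inf_kc_le_sup_kc a.1 b.1, BZLattice.inf_kc_le_sup_kc a.2 b.2⟩
  bc_antitone _ _ h := ⟨BZLattice.bc_antitone _ _ h.1, BZLattice.bc_antitone _ _ h.2⟩
  inf_bc a := Prod.ext (BZLattice.inf_bc a.1) (BZLattice.inf_bc a.2)
  le_bc_bc a := ⟨BZLattice.le_bc_bc a.1, BZLattice.le_bc_bc a.2⟩
  bc_bc a := Prod.ext (BZLattice.bc_bc a.1) (BZLattice.bc_bc a.2)

/-- The variety of all BZ-lattices (with universe of discourse `Type u`).  Classes of BZ-lattices are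
sets of type `Set BZLat.{u}`. -/
structure BZLat : Type (u + 1) where
  carrier : Type u
  [str : BZLattice carrier]

instance instCoeSortBZLat : CoeSort BZLat.{u} (Type u) := ⟨BZLat.carrier⟩

instance instBZLatticeCarrier (A : BZLat.{u}) : BZLattice A.carrier := A.str

/-- Homomorphic images of members of `C`. -/
def classH (C : Set BZLat.{u}) : Set BZLat.{u} :=
  {A | ∃ B ∈ C, ∃ f : BZHom B A, Function.Surjective f.toFun}

/-- (Isomorphic copies of) subalgebras of members of `C`. -/
def classS (C : Set BZLat.{u}) : Set BZLat.{u} :=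
  {A | ∃ B ∈ C, ∃ f : BZHom A B, Function.Injective f.toFun}

/-- Direct products of families of members of `C`. -/
def classP (C : Set BZLat.{u}) : Set BZLat.{u} :=
  {A | ∃ (ι : Type u) (F : ι → BZLat.{u}), (∀ i, F i ∈ C) ∧ A = ⟨∀ i, F i⟩}

/-- The subvariety `V(C) = HSP(C)` of the variety of BZ-lattices generated by `C`. -/
def varGen (C : Set BZLat.{u}) : Set BZLat.{u} := classH (classS (classP C))

/-- The join of two varieties in the lattice of subvarieties: the variety generated by their
union. -/
def varJoin (V W : Set BZLat.{u}) : Set BZLat.{u} := varGen (V ∪ W)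

/-- The subdirect product of `V` and `W`: all isomorphic copies of subalgebras of `A × B`, with
`A ∈ V` and `B ∈ W`, which both projections map onto the factors. -/
def subdirectProd (V W : Set BZLat.{u}) : Set BZLat.{u} :=
  {M | ∃ A ∈ V, ∃ B ∈ W, ∃ f : BZHom M (A × B), Function.Injective f.toFun ∧
    Function.Surjective (fun x => (f.toFun x).1) ∧ Function.Surjective (fun x => (f.toFun x).2)}

/-- PBZ*-lattices: paraorthomodular BZ-lattices that satisfy `(x ⊓ x')~ = x~ ⊔ x'~`. -/
def PBZLStar : Set BZLat.{u} :=
  {A | (∀ a b : A, a ≤ b → BZLattice.kc a ⊓ b = ⊥ → a = b) ∧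
    ∀ x : A, BZLattice.bc (x ⊓ BZLattice.kc x) = BZLattice.bc x ⊔ BZLattice.bc (BZLattice.kc x)}

/-- Orthomodular lattices, seen as BZ-lattices whose Brouwer complement equals their Kleene
complement.  (The orthomodular law with `b = ⊤` yields `a' ⊔ a = ⊤`.) -/
def OML : Set BZLat.{u} :=
  {A | (∀ a b : A, a ≤ b → b = (b ⊓ BZLattice.kc a) ⊔ a) ∧
    ∀ a : A, BZLattice.bc a = BZLattice.kc a}

/-- The set of sharp elements `x`, that is, those with `x ⊔ x' = ⊤`. -/
def sharp (A : BZLat.{u}) : Set A := {x | x ⊔ BZLattice.kc x = ⊤}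

/-- Antiortholattices: PBZ*-lattices whose only sharp elements are `⊥` and `⊤`. -/
def AOL : Set BZLat.{u} := {A | A ∈ PBZLStar ∧ sharp A = {⊥, ⊤}}

/-- PBZ*-lattices that satisfy the Strong De Morgan identity `(x ⊓ y)~ = x~ ⊔ y~`. -/
def SDM : Set BZLat.{u} :=
  {A | A ∈ PBZLStar ∧ ∀ x y : A, BZLattice.bc (x ⊓ y) = BZLattice.bc x ⊔ BZLattice.bc y}

/-- The variety `SDM ∩ V(AOL)`. -/
def SAOL : Set BZLat.{u} := SDM ∩ varGen AOL

/-- The three-element chain `0 < 1 < 2` as a BZ-lattice: the Kleene complement is order reversal, and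
the Brouwer complement sends the bottom to the top and everything else to the bottom. -/
instance instBZLatticeFinThree : BZLattice (Fin 3) where
  toLattice := Fin.instLattice
  toBoundedOrder := Fin.instBoundedOrder
  kc a := a.rev
  bc a := if a = 0 then 2 else 0
  kc_antitone := by decide
  kc_kc := by decide
  inf_kc_le_sup_kc := by decide
  bc_antitone := by decide
  inf_bc := by decide
  le_bc_bc := by decide
  bc_bc := by decide

/-- The lift of a BZ-lattice to a larger type universe. -/
instance instBZLatticeULift (α : Type v) [BZLattice α] : BZLattice (ULift.{u} α) where
  kc a := ⟨BZLattice.kc a.down⟩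
  bc a := ⟨BZLattice.bc a.down⟩
  kc_antitone a b h := BZLattice.kc_antitone a.down b.down h
  kc_kc a := ULift.ext _ _ (BZLattice.kc_kc a.down)
  inf_kc_le_sup_kc a b := BZLattice.inf_kc_le_sup_kc a.down b.down
  bc_antitone a b h := BZLattice.bc_antitone a.down b.down h
  inf_bc a := ULift.ext _ _ (BZLattice.inf_bc a.down)
  le_bc_bc a := BZLattice.le_bc_bc a.down
  bc_bc a := ULift.ext _ _ (BZLattice.bc_bc a.down)

/-- The three-element antiortholattice chain `D₃`. -/
def D3 : BZLat.{u} := ⟨ULift.{u} (Fin 3)⟩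

end PBZ

/-! The equalities in (i) are an instance of a general fact: BZ-lattices have a lattice reduct,
hence a majority term, hence distributive congruences, and then the join of any two varieties
consists of subdirect products (`varJoin_eq_subdirectProd`). Take a member M of the join as an image
of some B that embeds in a product, and group the factors by the variety they lie in. The two
projection kernels on B meet trivially, and by `eq_of_mapKer_of_mapKer` so do the congruences they
induce on M.

What remains for (i) is that the classes are varieties. Paraorthomodularity is only a
quasi-identity, but in the presence of the star condition it is equivalent to an orthomodular
identity on the elements `x~~` (`PBZLStar_eq_models`).

For (ii), each strictness comes from an identity that survives in the smaller join and fails in one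
finite antiortholattice: `x~~ ⊓ (y ⊓ y') ≤ x` fails in the five-element chain, and Strong De Morgan
fails in two squares glued at a point. -/

namespace PBZ

open BZLattice

/-! ### Arithmetic of the two complements -/

section Basic

variable {α : Type u} [BZLattice α]

theorem kc_le_kc_iff {a b : α} : kc a ≤ kc b ↔ b ≤ a :=
  ⟨fun h => by simpa [kc_kc] using kc_antitone _ _ h, kc_antitone _ _⟩

theorem kc_inf (a b : α) : kc (a ⊓ b) = kc a ⊔ kc b := by
  apply le_antisymm
  · rw [← kc_le_kc_iff, kc_kc]
    refine le_inf ?_ ?_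
    · rw [← kc_le_kc_iff, kc_kc]; exact le_sup_left
    · rw [← kc_le_kc_iff, kc_kc]; exact le_sup_right
  · exact sup_le (kc_antitone _ _ inf_le_left) (kc_antitone _ _ inf_le_right)

theorem kc_sup (a b : α) : kc (a ⊔ b) = kc a ⊓ kc b := by
  rw [← kc_kc (kc a ⊓ kc b), kc_inf, kc_kc, kc_kc]

theorem kc_bot : kc (⊥ : α) = ⊤ := by
  rw [← top_le_iff, ← kc_le_kc_iff, kc_kc]; exact bot_le

theorem kc_top : kc (⊤ : α) = ⊥ := by rw [← kc_bot, kc_kc]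

/-- The Brouwer complement forms an antitone Galois connection with itself, which turns joins into
meets. -/
theorem le_bc_comm {a b : α} (h : a ≤ bc b) : b ≤ bc a :=
  (le_bc_bc b).trans (bc_antitone _ _ h)

theorem bc_sup (a b : α) : bc (a ⊔ b) = bc a ⊓ bc b :=
  le_antisymm (le_inf (bc_antitone _ _ le_sup_left) (bc_antitone _ _ le_sup_right))
    (le_bc_comm (sup_le (le_bc_comm inf_le_left) (le_bc_comm inf_le_right)))

theorem bc_bc_bc (a : α) : bc (bc (bc a)) = bc a :=
  le_antisymm (bc_antitone _ _ (le_bc_bc a)) (le_bc_bc _)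

theorem bc_bot : bc (⊥ : α) = ⊤ :=
  top_le_iff.1 (le_bc_comm bot_le)

theorem bc_le_kc (a : α) : bc a ≤ kc a := by
  rw [← kc_le_kc_iff, kc_kc, ← bc_bc]; exact le_bc_bc a

theorem kc_bc (a : α) : kc (bc a) = bc (bc a) := (bc_bc a).symm

theorem bc_inf_kc_bc (a : α) : bc a ⊓ kc (bc a) = ⊥ := by
  rw [kc_bc, inf_bc]

end Basic

/-! ### Paraorthomodularity as an identity -/

section Paraorthomodular

/-- The orthomodular law for the elements of the form `x~~`. -/
def ClosedOrthomodular (α : Type u) [BZLattice α] : Prop :=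
  ∀ x y : α, bc (bc x) = (bc (bc x) ⊓ bc (bc y)) ⊔ (bc (bc x) ⊓ bc (bc (bc x) ⊓ bc (bc y)))

variable {α : Type u} [BZLattice α]

/-- Put `b = x~~` and `a = b ⊓ y~~`. Both `a` and `s = b ⊓ a~` are Brouwer complements, so `a' = a~`
and `s ⊓ s' = ⊥`. Hence `(a ⊔ s)' ⊓ b = s' ⊓ s = ⊥`, and paraorthomodularity applies to `a ⊔ s ≤ b`.
-/
theorem closedOrthomodular_of_paraorthomodular
    (h : ∀ a b : α, a ≤ b → kc a ⊓ b = ⊥ → a = b) : ClosedOrthomodular α := by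
  intro x y
  set b := bc (bc x) with hb
  have ha : b ⊓ bc (bc y) = bc (bc x ⊔ bc y) := by rw [bc_sup]
  rw [ha]
  set a := bc (bc x ⊔ bc y) with ha'
  have hab : a ≤ b := ha ▸ inf_le_left
  refine (h _ _ (sup_le hab inf_le_left) ?_).symm
  have hs : b ⊓ bc a = bc (bc x ⊔ a) := by rw [bc_sup]
  rw [kc_sup, kc_bc, hs, inf_right_comm, ← ha', inf_comm (bc a), hs, inf_comm, inf_comm,
    bc_inf_kc_bc]

theorem eq_of_closedOrthomodular (h : ClosedOrthomodular α) {a b : α}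
    (ha : bc (bc a) = a) (hb : bc (bc b) = b) (hab : a ≤ b) (h0 : kc a ⊓ b = ⊥) : a = b := by
  have := h b a
  rw [ha, hb, inf_eq_right.2 hab] at this
  have h1 : bc a = kc a := by rw [← ha, bc_bc_bc, bc_bc, kc_kc]
  rw [h1, inf_comm, h0, sup_bot_eq] at this
  exact this.symm

/-- The star condition gives `a~ ⊔ a'~ = ⊤`, that is, `a~~ ⊓ (a'~)' = ⊥`. As `a'~ ≤ a ≤ a~~` with
closed outer terms, these coincide and squeeze `a`. -/
theorem bc_bc_eq_of_inf_kc_eq_bot (h : ClosedOrthomodular α)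
    (hstar : ∀ x : α, bc (x ⊓ kc x) = bc x ⊔ bc (kc x)) {a : α} (ha : a ⊓ kc a = ⊥) :
    bc (bc a) = a := by
  have h1 := hstar a
  rw [ha, bc_bot] at h1
  have h2 : bc (bc a) ⊓ kc (bc (kc a)) = ⊥ := by
    rw [bc_bc, ← kc_sup, ← h1, kc_top]
  have h3 : bc (kc a) ≤ a := by simpa [kc_kc] using bc_le_kc (kc a)
  have h4 := eq_of_closedOrthomodular h (bc_bc_bc _) (bc_bc_bc _) (h3.trans (le_bc_bc a))
    (by rw [inf_comm, h2])
  exact le_antisymm (h4 ▸ h3) (le_bc_bc a)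

/-- Both `a ⊓ a'` and `b ⊓ b'` lie below `a' ⊓ b = ⊥`, so `a` and `b` are closed and the
orthomodular law for closed elements suffices. -/
theorem paraorthomodular_of_closedOrthomodular (h : ClosedOrthomodular α)
    (hstar : ∀ x : α, bc (x ⊓ kc x) = bc x ⊔ bc (kc x)) (a b : α) (hab : a ≤ b)
    (h0 : kc a ⊓ b = ⊥) : a = b := by
  refine eq_of_closedOrthomodular h (bc_bc_eq_of_inf_kc_eq_bot h hstar ?_)
    (bc_bc_eq_of_inf_kc_eq_bot h hstar ?_) hab h0
  · rw [← le_bot_iff, ← h0, inf_comm]; exact inf_le_inf_left _ hab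
  · rw [← le_bot_iff, ← h0, inf_comm]; exact inf_le_inf_right _ (kc_antitone _ _ hab)

end Paraorthomodular

/-! ### Homomorphisms, subalgebras and congruences -/

namespace BZHom

variable {α : Type u} {β : Type v} [BZLattice α] [BZLattice β]

theorem map_inf (f : BZHom α β) (a b : α) : f.toFun (a ⊓ b) = f.toFun a ⊓ f.toFun b :=
  f.map_inf' a b

theorem map_sup (f : BZHom α β) (a b : α) : f.toFun (a ⊔ b) = f.toFun a ⊔ f.toFun b :=
  f.map_sup' a b

theorem map_kc (f : BZHom α β) (a : α) : f.toFun (kc a) = kc (f.toFun a) := f.map_kc' a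

theorem map_bc (f : BZHom α β) (a : α) : f.toFun (bc a) = bc (f.toFun a) := f.map_bc' a

theorem map_top (f : BZHom α β) : f.toFun ⊤ = ⊤ := f.map_top'

theorem map_bot (f : BZHom α β) : f.toFun ⊥ = ⊥ := f.map_bot'

/-- The identity homomorphism. -/
def id (α : Type u) [BZLattice α] : BZHom α α where
  toBoundedLatticeHom := BoundedLatticeHom.id α
  map_kc' _ := rfl
  map_bc' _ := rfl

/-- Composition of homomorphisms. -/
def comp {γ : Type*} [BZLattice γ] (g : BZHom β γ) (f : BZHom α β) : BZHom α γ where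
  toFun x := g.toFun (f.toFun x)
  map_sup' a b := by rw [f.map_sup, g.map_sup]
  map_inf' a b := by rw [f.map_inf, g.map_inf]
  map_top' := by rw [f.map_top, g.map_top]
  map_bot' := by rw [f.map_bot, g.map_bot]
  map_kc' a := by rw [f.map_kc, g.map_kc]
  map_bc' a := by rw [f.map_bc, g.map_bc]

/-- The first projection of a binary product. -/
def fst (α : Type u) (β : Type v) [BZLattice α] [BZLattice β] : BZHom (α × β) α where
  toFun := Prod.fst
  map_sup' _ _ := rfl
  map_inf' _ _ := rfl
  map_top' := rfl
  map_bot' := rfl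
  map_kc' _ := rfl
  map_bc' _ := rfl

/-- The second projection of a binary product. -/
def snd (α : Type u) (β : Type v) [BZLattice α] [BZLattice β] : BZHom (α × β) β where
  toFun := Prod.snd
  map_sup' _ _ := rfl
  map_inf' _ _ := rfl
  map_top' := rfl
  map_bot' := rfl
  map_kc' _ := rfl
  map_bc' _ := rfl

/-- The homomorphism into a binary product with given components. -/
def prod {γ : Type*} [BZLattice γ] (f : BZHom γ α) (g : BZHom γ β) : BZHom γ (α × β) where
  toFun x := (f.toFun x, g.toFun x)
  map_sup' a b := Prod.ext (f.map_sup a b) (g.map_sup a b)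
  map_inf' a b := Prod.ext (f.map_inf a b) (g.map_inf a b)
  map_top' := Prod.ext f.map_top g.map_top
  map_bot' := Prod.ext f.map_bot g.map_bot
  map_kc' a := Prod.ext (f.map_kc a) (g.map_kc a)
  map_bc' a := Prod.ext (f.map_bc a) (g.map_bc a)

/-- The projections of a product. -/
def proj {ι : Type v} (F : ι → Type u) [∀ i, BZLattice (F i)] (i : ι) :
    BZHom (∀ i, F i) (F i) where
  toFun x := x i
  map_sup' _ _ := rfl
  map_inf' _ _ := rfl
  map_top' := rfl
  map_bot' := rfl
  map_kc' _ := rfl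
  map_bc' _ := rfl

/-- The homomorphism into a product with given components. -/
def pi {ι : Type*} {F : ι → Type*} [∀ i, BZLattice (F i)] (f : ∀ i, BZHom α (F i)) :
    BZHom α (∀ i, F i) where
  toFun x i := (f i).toFun x
  map_sup' a b := funext fun i => (f i).map_sup a b
  map_inf' a b := funext fun i => (f i).map_inf a b
  map_top' := funext fun i => (f i).map_top
  map_bot' := funext fun i => (f i).map_bot
  map_kc' a := funext fun i => (f i).map_kc a
  map_bc' a := funext fun i => (f i).map_bc a

end BZHom

/-- Subalgebras of a BZ-lattice. -/
structure BZSub (α : Type u) [BZLattice α] where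
  carrier : Set α
  inf_mem : ∀ {a b}, a ∈ carrier → b ∈ carrier → a ⊓ b ∈ carrier
  sup_mem : ∀ {a b}, a ∈ carrier → b ∈ carrier → a ⊔ b ∈ carrier
  top_mem : ⊤ ∈ carrier
  bot_mem : ⊥ ∈ carrier
  kc_mem : ∀ {a}, a ∈ carrier → kc a ∈ carrier
  bc_mem : ∀ {a}, a ∈ carrier → bc a ∈ carrier

namespace BZSub

variable {α : Type u} [BZLattice α]

instance instBZLattice (s : BZSub α) : BZLattice s.carrier where
  toLattice := Subtype.lattice (fun _ _ => s.sup_mem) (fun _ _ => s.inf_mem)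
  toBoundedOrder := Subtype.boundedOrder s.bot_mem s.top_mem
  kc a := ⟨kc a.1, s.kc_mem a.2⟩
  bc a := ⟨bc a.1, s.bc_mem a.2⟩
  kc_antitone a b h := kc_antitone a.1 b.1 h
  kc_kc a := Subtype.ext (kc_kc a.1)
  inf_kc_le_sup_kc a b := inf_kc_le_sup_kc a.1 b.1
  bc_antitone a b h := bc_antitone a.1 b.1 h
  inf_bc a := Subtype.ext (inf_bc a.1)
  le_bc_bc a := le_bc_bc a.1
  bc_bc a := Subtype.ext (bc_bc a.1)

/-- The inclusion of a subalgebra. -/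
def incl (s : BZSub α) : BZHom s.carrier α where
  toFun x := x.1
  map_sup' _ _ := rfl
  map_inf' _ _ := rfl
  map_top' := rfl
  map_bot' := rfl
  map_kc' _ := rfl
  map_bc' _ := rfl

/-- The pullback of two homomorphisms. -/
def pullback {β γ : Type u} [BZLattice β] [BZLattice γ] (f : BZHom α γ) (g : BZHom β γ) :
    BZSub (α × β) where
  carrier := {x | f.toFun x.1 = g.toFun x.2}
  inf_mem {a b} ha hb := by
    change f.toFun (a.1 ⊓ b.1) = g.toFun (a.2 ⊓ b.2)
    rw [f.map_inf, g.map_inf, Set.mem_ofPred.1 ha, Set.mem_ofPred.1 hb]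
  sup_mem {a b} ha hb := by
    change f.toFun (a.1 ⊔ b.1) = g.toFun (a.2 ⊔ b.2)
    rw [f.map_sup, g.map_sup, Set.mem_ofPred.1 ha, Set.mem_ofPred.1 hb]
  top_mem := f.map_top.trans g.map_top.symm
  bot_mem := f.map_bot.trans g.map_bot.symm
  kc_mem {a} ha := by
    change f.toFun (kc a.1) = g.toFun (kc a.2)
    rw [f.map_kc, g.map_kc, Set.mem_ofPred.1 ha]
  bc_mem {a} ha := by
    change f.toFun (bc a.1) = g.toFun (bc a.2)
    rw [f.map_bc, g.map_bc, Set.mem_ofPred.1 ha]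

end BZSub

/-- Congruences of a BZ-lattice. -/
structure BZCon (α : Type u) [BZLattice α] extends Setoid α where
  inf' : ∀ {a b c d}, r a b → r c d → r (a ⊓ c) (b ⊓ d)
  sup' : ∀ {a b c d}, r a b → r c d → r (a ⊔ c) (b ⊔ d)
  kc' : ∀ {a b}, r a b → r (kc a) (kc b)
  bc' : ∀ {a b}, r a b → r (bc a) (bc b)

namespace BZCon

variable {α : Type u} [BZLattice α]

/-- The underlying type of the quotient by a congruence. -/
def Quot (c : BZCon α) : Type u := Quotient c.toSetoid

variable (c : BZCon α)

/-- The canonical map onto the quotient. -/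
def toQuot (a : α) : c.Quot := Quotient.mk c.toSetoid a

theorem toQuot_surjective : Function.Surjective c.toQuot := Quotient.mk_surjective

theorem toQuot_eq {a b : α} : c.toQuot a = c.toQuot b ↔ c.r a b := Quotient.eq (r := c.toSetoid)

instance instMax : Max c.Quot := ⟨Quotient.map₂ (· ⊔ ·) fun _ _ h _ _ h' => c.sup' h h'⟩

instance instMin : Min c.Quot := ⟨Quotient.map₂ (· ⊓ ·) fun _ _ h _ _ h' => c.inf' h h'⟩

theorem toQuot_sup (a b : α) : c.toQuot (a ⊔ b) = c.toQuot a ⊔ c.toQuot b := rfl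

theorem toQuot_inf (a b : α) : c.toQuot (a ⊓ b) = c.toQuot a ⊓ c.toQuot b := rfl

instance instLattice : Lattice c.Quot :=
  Lattice.mk'
    (c.toQuot_surjective.forall₂.2 fun a b => by rw [← toQuot_sup, ← toQuot_sup, sup_comm])
    (c.toQuot_surjective.forall₃.2 fun a b d => by simp only [← toQuot_sup, sup_assoc])
    (c.toQuot_surjective.forall₂.2 fun a b => by rw [← toQuot_inf, ← toQuot_inf, inf_comm])
    (c.toQuot_surjective.forall₃.2 fun a b d => by simp only [← toQuot_inf, inf_assoc])
    (c.toQuot_surjective.forall₂.2 fun a b => by rw [← toQuot_inf, ← toQuot_sup, sup_inf_self])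
    (c.toQuot_surjective.forall₂.2 fun a b => by rw [← toQuot_sup, ← toQuot_inf, inf_sup_self])

theorem toQuot_mono {a b : α} (h : a ≤ b) : c.toQuot a ≤ c.toQuot b := by
  rw [← sup_eq_right]
  change c.toQuot a ⊔ c.toQuot b = c.toQuot b
  rw [← toQuot_sup, sup_eq_right.2 h]

theorem exists_rep_of_le {x y : c.Quot} (h : x ≤ y) : ∃ a b, a ≤ b ∧ c.toQuot a = x ∧ c.toQuot b = y := by
  obtain ⟨a, rfl⟩ := c.toQuot_surjective x
  obtain ⟨b, rfl⟩ := c.toQuot_surjective y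
  exact ⟨a, a ⊔ b, le_sup_left, rfl, sup_eq_right.2 h⟩

instance instBoundedOrder : BoundedOrder c.Quot where
  top := c.toQuot ⊤
  bot := c.toQuot ⊥
  le_top := c.toQuot_surjective.forall.2 fun _ => c.toQuot_mono le_top
  bot_le := c.toQuot_surjective.forall.2 fun _ => c.toQuot_mono bot_le

instance instBZLattice : BZLattice c.Quot where
  kc := Quotient.map kc fun _ _ h => c.kc' h
  bc := Quotient.map bc fun _ _ h => c.bc' h
  kc_antitone x y h := by
    obtain ⟨a, b, hab, rfl, rfl⟩ := c.exists_rep_of_le h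
    exact c.toQuot_mono (kc_antitone _ _ hab)
  kc_kc := c.toQuot_surjective.forall.2 fun a => congrArg c.toQuot (kc_kc a)
  inf_kc_le_sup_kc := c.toQuot_surjective.forall₂.2 fun a b => c.toQuot_mono (inf_kc_le_sup_kc a b)
  bc_antitone x y h := by
    obtain ⟨a, b, hab, rfl, rfl⟩ := c.exists_rep_of_le h
    exact c.toQuot_mono (bc_antitone _ _ hab)
  inf_bc := c.toQuot_surjective.forall.2 fun a => congrArg c.toQuot (inf_bc a)
  le_bc_bc := c.toQuot_surjective.forall.2 fun a => c.toQuot_mono (le_bc_bc a)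
  bc_bc := c.toQuot_surjective.forall.2 fun a => congrArg c.toQuot (bc_bc a)

/-- The canonical homomorphism onto the quotient. -/
def toQuotHom : BZHom α c.Quot where
  toFun := c.toQuot
  map_sup' _ _ := rfl
  map_inf' _ _ := rfl
  map_top' := rfl
  map_bot' := rfl
  map_kc' _ := rfl
  map_bc' _ := rfl

/-- The homomorphism on the quotient induced by a homomorphism that respects the congruence. -/
def lift {β : Type v} [BZLattice β] (g : BZHom α β) (h : ∀ a b, c.r a b → g.toFun a = g.toFun b) :
    BZHom c.Quot β where
  toFun := Quotient.lift g.toFun h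
  map_sup' := c.toQuot_surjective.forall₂.2 g.map_sup
  map_inf' := c.toQuot_surjective.forall₂.2 g.map_inf
  map_top' := g.map_top
  map_bot' := g.map_bot
  map_kc' := c.toQuot_surjective.forall.2 g.map_kc
  map_bc' := c.toQuot_surjective.forall.2 g.map_bc

/-- The kernel of a homomorphism. -/
def ker {β : Type v} [BZLattice β] (g : BZHom α β) : BZCon α where
  toSetoid := Setoid.ker g.toFun
  inf' {a b c d} h h' := by
    change g.toFun _ = g.toFun _
    rw [g.map_inf, g.map_inf, show g.toFun a = g.toFun b from h, show g.toFun c = g.toFun d from h']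
  sup' {a b c d} h h' := by
    change g.toFun _ = g.toFun _
    rw [g.map_sup, g.map_sup, show g.toFun a = g.toFun b from h, show g.toFun c = g.toFun d from h']
  kc' {a b} h := by
    change g.toFun _ = g.toFun _
    rw [g.map_kc, g.map_kc, show g.toFun a = g.toFun b from h]
  bc' {a b} h := by
    change g.toFun _ = g.toFun _
    rw [g.map_bc, g.map_bc, show g.toFun a = g.toFun b from h]

open Relation in
/-- The transitive closure of a reflexive and symmetric compatible relation, as a congruence. -/
def ofTolerance (r : α → α → Prop) (hrefl : ∀ a, r a a) (hsymm : ∀ a b, r a b → r b a)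
    (hinf : ∀ a b c d, r a b → r c d → r (a ⊓ c) (b ⊓ d))
    (hsup : ∀ a b c d, r a b → r c d → r (a ⊔ c) (b ⊔ d))
    (hkc : ∀ a b, r a b → r (kc a) (kc b)) (hbc : ∀ a b, r a b → r (bc a) (bc b)) : BZCon α where
  r := ReflTransGen r
  iseqv := ⟨fun _ => .refl, fun h => (@ReflTransGen.stdSymm _ _ ⟨hsymm⟩).symm _ _ h,
    fun h h' => h.trans h'⟩
  inf' {_ b c _} h h' := (h.lift (· ⊓ c) fun _ _ hs => hinf _ _ _ _ hs (hrefl c)).trans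
    (h'.lift (b ⊓ ·) fun _ _ hs => hinf _ _ _ _ (hrefl b) hs)
  sup' {_ b c _} h h' := (h.lift (· ⊔ c) fun _ _ hs => hsup _ _ _ _ hs (hrefl c)).trans
    (h'.lift (b ⊔ ·) fun _ _ hs => hsup _ _ _ _ (hrefl b) hs)
  kc' h := h.lift kc hkc
  bc' h := h.lift bc hbc

/-- The relation that a homomorphism `f` induces on its codomain from the kernel of `p`. -/
def ImageKer {β γ : Type*} [BZLattice β] [BZLattice γ] (f : BZHom β α) (p : BZHom β γ)
    (a b : α) : Prop :=
  ∃ x y, f.toFun x = a ∧ f.toFun y = b ∧ p.toFun x = p.toFun y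

/-- The congruence generated by the image, under a surjective homomorphism `f`, of the kernel of
`p`. -/
def mapKer {β γ : Type*} [BZLattice β] [BZLattice γ] (f : BZHom β α)
    (hf : Function.Surjective f.toFun) (p : BZHom β γ) : BZCon α :=
  -- The image of a kernel is reflexive, symmetric and compatible, but need not be transitive when
  -- `f` is not injective.
  ofTolerance (ImageKer f p) (hf.forall.2 fun x => ⟨x, x, rfl, rfl, rfl⟩)
    (by rintro _ _ ⟨x, y, rfl, rfl, h⟩; exact ⟨y, x, rfl, rfl, h.symm⟩)
    (by
      rintro _ _ _ _ ⟨x, y, rfl, rfl, h⟩ ⟨z, w, rfl, rfl, h'⟩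
      exact ⟨x ⊓ z, y ⊓ w, f.map_inf _ _, f.map_inf _ _, by rw [p.map_inf, p.map_inf, h, h']⟩)
    (by
      rintro _ _ _ _ ⟨x, y, rfl, rfl, h⟩ ⟨z, w, rfl, rfl, h'⟩
      exact ⟨x ⊔ z, y ⊔ w, f.map_sup _ _, f.map_sup _ _, by rw [p.map_sup, p.map_sup, h, h']⟩)
    (by
      rintro _ _ ⟨x, y, rfl, rfl, h⟩
      exact ⟨kc x, kc y, f.map_kc _, f.map_kc _, by rw [p.map_kc, p.map_kc, h]⟩)
    (by
      rintro _ _ ⟨x, y, rfl, rfl, h⟩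
      exact ⟨bc x, bc y, f.map_bc _, f.map_bc _, by rw [p.map_bc, p.map_bc, h]⟩)

end BZCon

/-! ### Congruence distributivity from the majority term -/

section CongruenceDistributivity

/-- The majority term of lattices. -/
def maj {α : Type*} [Lattice α] (a b c : α) : α := (a ⊓ b) ⊔ (a ⊓ c) ⊔ (b ⊓ c)

theorem maj_self_left {α : Type*} [Lattice α] (a c : α) : maj a a c = a := by
  simp [maj]

theorem maj_self_mid {α : Type*} [Lattice α] (a b : α) : maj a b a = a := by
  simp [maj, inf_comm]

theorem maj_self_right {α : Type*} [Lattice α] (a b : α) : maj a b b = b := by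
  simp [maj]

variable {α β γ δ : Type*} [BZLattice α] [BZLattice β] [BZLattice γ] [BZLattice δ]

theorem BZHom.map_maj (f : BZHom α β) (a b c : α) :
    f.toFun (maj a b c) = maj (f.toFun a) (f.toFun b) (f.toFun c) := by
  simp only [maj, f.map_sup, f.map_inf]

theorem BZCon.maj (r : BZCon α) {a a' b b' c c' : α} (ha : r.r a a') (hb : r.r b b')
    (hc : r.r c c') : r.r (maj a b c) (maj a' b' c') :=
  r.sup' (r.sup' (r.inf' ha hb) (r.inf' ha hc)) (r.inf' hb hc)

/-- With `a = f x`, `b = f y`, the value `maj a b c` stays constant as `c` runs along a `q`-chain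
from `a` to `b`: for a step from `f z` to `f w`, the elements `maj x y z` and `maj x y w` agree
under `p`, where both become `p x`, and under `q`. The ends of the chain give `a` and `b`. -/
theorem eq_of_imageKer_of_mapKer (f : BZHom β α) (hf : Function.Surjective f.toFun)
    (p : BZHom β γ) (q : BZHom β δ)
    (hpq : ∀ x y, p.toFun x = p.toFun y → q.toFun x = q.toFun y → x = y) {a b : α}
    (h₁ : BZCon.ImageKer f p a b) (h₂ : (BZCon.mapKer f hf q).r a b) : a = b := by
  obtain ⟨x, y, rfl, rfl, hxy⟩ := h₁
  have key : ∀ c, Relation.ReflTransGen (BZCon.ImageKer f q) (f.toFun x) c →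
      maj (f.toFun x) (f.toFun y) c = f.toFun x := by
    intro c hc
    induction hc with
    | refl => exact maj_self_mid _ _
    | tail _ hs ih =>
      obtain ⟨z, w, rfl, rfl, hzw⟩ := hs
      refine Eq.trans ?_ ih
      rw [← f.map_maj, ← f.map_maj]
      congr 1
      apply hpq
      · simp only [p.map_maj, hxy, maj_self_left]
      · simp only [q.map_maj, hzw]
  rw [← key _ h₂, maj_self_right]

/-- Congruence distributivity: if `p` and `q` separate points, then so do the congruences on a
homomorphic image that their kernels induce. -/
theorem eq_of_mapKer_of_mapKer (f : BZHom β α) (hf : Function.Surjective f.toFun)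
    (p : BZHom β γ) (q : BZHom β δ)
    (hpq : ∀ x y, p.toFun x = p.toFun y → q.toFun x = q.toFun y → x = y) {a b : α}
    (h₁ : (BZCon.mapKer f hf p).r a b) (h₂ : (BZCon.mapKer f hf q).r a b) : a = b := by
  -- Since `b` is `q`-related to `a`, every `maj a b c` is too; so for any `c` and `d`, `maj a b c`
  -- and `maj a b d` are `q`-related.
  have hq : ∀ c, (BZCon.mapKer f hf q).r a (maj a b c) := fun c => by
    have h := (BZCon.mapKer f hf q).maj ((BZCon.mapKer f hf q).iseqv.refl a) h₂
      ((BZCon.mapKer f hf q).iseqv.refl c)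
    rwa [maj_self_left] at h
  have key : ∀ c, Relation.ReflTransGen (BZCon.ImageKer f p) a c → maj a b c = a := by
    intro c hc
    induction hc with
    | refl => exact maj_self_mid _ _
    -- One `p`-step from `c` to `d` yields one `p`-step between the majority values, to which the
    -- one-step case applies.
    | @tail c d _ hs ih =>
      refine Eq.trans ?_ ih
      refine (eq_of_imageKer_of_mapKer f hf p q hpq ?_
        ((BZCon.mapKer f hf q).iseqv.trans ((BZCon.mapKer f hf q).iseqv.symm (hq c)) (hq d))).symm
      obtain ⟨z, w, rfl, rfl, hzw⟩ := hs
      obtain ⟨x, rfl⟩ := hf a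
      obtain ⟨y, rfl⟩ := hf b
      exact ⟨maj x y z, maj x y w, f.map_maj _ _ _, f.map_maj _ _ _, by
        simp only [p.map_maj, hzw]⟩
  rw [← key _ h₁, maj_self_right]

end CongruenceDistributivity

/-! ### Varieties, HSP and joins -/

section Varieties

/-- Classes of BZ-lattices closed under homomorphic images, subalgebras and products. -/
structure IsVariety (V : Set BZLat.{u}) : Prop where
  classH_subset : classH V ⊆ V
  classS_subset : classS V ⊆ V
  classP_subset : classP V ⊆ V

variable {C D V W : Set BZLat.{u}}

theorem IsVariety.inter (hV : IsVariety V) (hW : IsVariety W) : IsVariety (V ∩ W) where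
  classH_subset := by
    rintro A ⟨B, hB, f, hf⟩
    exact ⟨hV.classH_subset ⟨B, hB.1, f, hf⟩, hW.classH_subset ⟨B, hB.2, f, hf⟩⟩
  classS_subset := by
    rintro A ⟨B, hB, f, hf⟩
    exact ⟨hV.classS_subset ⟨B, hB.1, f, hf⟩, hW.classS_subset ⟨B, hB.2, f, hf⟩⟩
  classP_subset := by
    rintro A ⟨ι, F, hF, rfl⟩
    exact ⟨hV.classP_subset ⟨ι, F, fun i => (hF i).1, rfl⟩,
      hW.classP_subset ⟨ι, F, fun i => (hF i).2, rfl⟩⟩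

theorem varGen_mono (h : C ⊆ D) : varGen C ⊆ varGen D := by
  rintro A ⟨B, ⟨_, ⟨ι, F, hF, rfl⟩, p, hp⟩, f, hf⟩
  exact ⟨B, ⟨_, ⟨ι, F, fun i => h (hF i), rfl⟩, p, hp⟩, f, hf⟩

theorem varGen_subset (hV : IsVariety V) (h : C ⊆ V) : varGen C ⊆ V := by
  rintro A ⟨B, ⟨_, ⟨ι, F, hF, rfl⟩, p, hp⟩, f, hf⟩
  exact hV.classH_subset ⟨B, hV.classS_subset ⟨_, hV.classP_subset ⟨ι, F, fun i => h (hF i), rfl⟩,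
    p, hp⟩, f, hf⟩

/-- A homomorphic image of `B` whose kernel contains the kernel of a homomorphism from `B` to `A` is
a homomorphic image of a subalgebra of `A`. -/
theorem mem_classH_classS {A B Q : BZLat.{u}} (hA : A ∈ C) (p : BZHom B A) (g : BZHom B Q)
    (hg : Function.Surjective g.toFun) (h : ∀ x y, p.toFun x = p.toFun y → g.toFun x = g.toFun y) :
    Q ∈ classH (classS C) :=
  ⟨⟨(BZCon.ker p).Quot⟩, ⟨A, hA, (BZCon.ker p).lift p fun _ _ h => h,
      ((BZCon.ker p).toQuot_surjective.forall₂.2 fun _ _ h => (BZCon.ker p).toQuot_eq.2 h)⟩,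
    (BZCon.ker p).lift g h, fun z => by
      obtain ⟨x, rfl⟩ := hg z
      exact ⟨(BZCon.ker p).toQuot x, rfl⟩⟩

/-- A working criterion for HSP: `B` itself need not embed in the product, as long as `g` identifies
whatever all the `p i` identify. -/
theorem mem_varGen_of_hom {ι : Type u} {F : ι → BZLat.{u}} (hF : ∀ i, F i ∈ C) {B Q : BZLat.{u}}
    (p : ∀ i, BZHom B (F i)) (g : BZHom B Q) (hg : Function.Surjective g.toFun)
    (h : ∀ x y, (∀ i, (p i).toFun x = (p i).toFun y) → g.toFun x = g.toFun y) : Q ∈ varGen C :=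
  mem_classH_classS (A := ⟨∀ i, F i⟩) ⟨ι, F, hF, rfl⟩ (BZHom.pi p) g hg
    fun x y hxy => h x y fun i => congrFun hxy i

theorem exists_hom_of_mem_varGen {Q : BZLat.{u}} (hQ : Q ∈ varGen C) :
    ∃ (ι : Type u) (F : ι → BZLat.{u}) (_ : ∀ i, F i ∈ C) (B : BZLat.{u})
      (p : ∀ i, BZHom B (F i)) (g : BZHom B Q), Function.Surjective g.toFun ∧
      ∀ x y, (∀ i, (p i).toFun x = (p i).toFun y) → x = y := by
  obtain ⟨B, ⟨_, ⟨ι, F, hF, rfl⟩, p, hp⟩, f, hf⟩ := hQ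
  exact ⟨ι, F, hF, B, fun i => (BZHom.proj (fun i => F i) i).comp p, f, hf,
    fun x y h => hp (funext h)⟩

theorem subset_varGen (C : Set BZLat.{u}) : C ⊆ varGen C := fun A hA =>
  mem_varGen_of_hom (ι := PUnit) (F := fun _ => A) (fun _ => hA) (fun _ => BZHom.id A)
    (BZHom.id A) (fun x => ⟨x, rfl⟩) fun _ _ h => h PUnit.unit

theorem isVariety_varGen (C : Set BZLat.{u}) : IsVariety (varGen C) where
  classH_subset := by
    rintro A ⟨B, ⟨D, hD, f, hf⟩, g, hg⟩
    exact ⟨D, hD, g.comp f, hg.comp hf⟩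
  classS_subset := by
    rintro A ⟨Q, hQ, e, he⟩
    obtain ⟨ι, F, hF, B, p, g, hg, h⟩ := exists_hom_of_mem_varGen hQ
    -- A subalgebra of an image is an image of its preimage; the pullback plays the role of that
    -- preimage.
    let s := BZSub.pullback e g
    refine mem_varGen_of_hom (B := ⟨s.carrier⟩) hF
      (fun i => (p i).comp ((BZHom.snd _ _).comp s.incl)) ((BZHom.fst _ _).comp s.incl) ?_ ?_
    · intro a
      obtain ⟨b, hb⟩ := hg (e.toFun a)
      exact ⟨⟨(a, b), hb.symm⟩, rfl⟩
    · rintro ⟨⟨a, b⟩, hab⟩ ⟨⟨a', b'⟩, hab'⟩ hp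
      obtain rfl : b = b' := h _ _ hp
      exact he (Eq.trans hab (Eq.symm hab'))
  classP_subset := by
    rintro _ ⟨J, Q, hQ, rfl⟩
    choose ι F hF B p g hg h using fun j => exists_hom_of_mem_varGen (hQ j)
    refine mem_varGen_of_hom (ι := Σ j, ι j) (F := fun i => F i.1 i.2) (B := ⟨∀ j, B j⟩)
      (fun i => hF i.1 i.2) (fun i => (p i.1 i.2).comp (BZHom.proj (fun j => B j) i.1))
      (BZHom.pi fun j => (g j).comp (BZHom.proj (fun j => B j) j)) ?_ ?_
    · intro z
      choose b hb using fun j => hg j (z j)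
      exact ⟨b, funext hb⟩
    · intro x y hxy
      exact congrArg _ (funext fun j => h j _ _ fun i => hxy ⟨j, i⟩)

theorem subdirectProd_subset_varJoin (V W : Set BZLat.{u}) :
    subdirectProd V W ⊆ varJoin V W := by
  rintro M ⟨A, hA, B, hB, f, hf, -, -⟩
  refine mem_varGen_of_hom (ι := ULift Bool) (F := fun i => bif i.down then A else B) (B := M) ?_
    (fun i => match i with
      | ⟨true⟩ => (BZHom.fst A B).comp f
      | ⟨false⟩ => (BZHom.snd A B).comp f) (BZHom.id M) (fun x => ⟨x, rfl⟩) ?_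
  · rintro ⟨_ | _⟩
    · exact Or.inr hB
    · exact Or.inl hA
  · intro x y h
    exact hf (Prod.ext (h ⟨true⟩) (h ⟨false⟩))

theorem varJoin_subset_subdirectProd (hV : IsVariety V) (hW : IsVariety W) :
    varJoin V W ⊆ subdirectProd V W := by
  intro M hM
  obtain ⟨ι, F, hF, B, p, g, hg, h⟩ := exists_hom_of_mem_varGen hM
  -- Factors lying in both `V` and `W` are used twice, which is harmless: only joint separation of
  -- points matters.
  let q₁ : BZHom B (∀ i : {i // F i ∈ V}, F i) := BZHom.pi fun i => p i
  let q₂ : BZHom B (∀ i : {i // F i ∈ W}, F i) := BZHom.pi fun i => p i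
  have hq : ∀ x y, q₁.toFun x = q₁.toFun y → q₂.toFun x = q₂.toFun y → x = y := by
    intro x y h₁ h₂
    refine h x y fun i => (hF i).elim (fun hi => congrFun h₁ ⟨i, hi⟩) fun hi => congrFun h₂ ⟨i, hi⟩
  have key : ∀ (U : Set BZLat.{u}) (_ : IsVariety U) (q : BZHom B (∀ i : {i // F i ∈ U}, F i)),
      (⟨(BZCon.mapKer g hg q).Quot⟩ : BZLat.{u}) ∈ U := by
    intro U hU q
    have hP : (⟨∀ i : {i // F i ∈ U}, F i⟩ : BZLat.{u}) ∈ U :=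
      hU.classP_subset ⟨_, fun i : {i // F i ∈ U} => F i, fun i => i.2, rfl⟩
    obtain ⟨D, hD, e, he⟩ := mem_classH_classS (Q := ⟨(BZCon.mapKer g hg q).Quot⟩)
      (C := {⟨∀ i : {i // F i ∈ U}, F i⟩}) rfl q
      ((BZCon.mapKer g hg q).toQuotHom.comp g)
      ((BZCon.mapKer g hg q).toQuot_surjective.comp hg) fun x y hxy =>
        (BZCon.mapKer g hg q).toQuot_eq.2 (.single ⟨x, y, rfl, rfl, hxy⟩)
    obtain ⟨E, rfl, e', he'⟩ := hD
    exact hU.classH_subset ⟨D, hU.classS_subset ⟨_, hP, e', he'⟩, e, he⟩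
  refine ⟨_, key V hV q₁, _, key W hW q₂, BZHom.prod (BZCon.mapKer g hg q₁).toQuotHom
    (BZCon.mapKer g hg q₂).toQuotHom, ?_, (BZCon.mapKer g hg q₁).toQuot_surjective,
    (BZCon.mapKer g hg q₂).toQuot_surjective⟩
  intro a b hab
  exact eq_of_mapKer_of_mapKer g hg q₁ q₂ hq
    ((BZCon.mapKer g hg q₁).toQuot_eq.1 (congrArg Prod.fst hab))
    ((BZCon.mapKer g hg q₂).toQuot_eq.1 (congrArg Prod.snd hab))

/-- The join of two varieties of BZ-lattices consists of the subdirect products of their members. -/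
theorem varJoin_eq_subdirectProd (hV : IsVariety V) (hW : IsVariety W) :
    varJoin V W = subdirectProd V W :=
  (varJoin_subset_subdirectProd hV hW).antisymm (subdirectProd_subset_varJoin V W)

end Varieties

/-! ### Equational descriptions of the classes -/

section Identities

/-- Terms in the language of BZ-lattices, with variables indexed by `ℕ`. -/
inductive BZTerm : Type
  | var : ℕ → BZTerm
  | inf : BZTerm → BZTerm → BZTerm
  | sup : BZTerm → BZTerm → BZTerm
  | kc : BZTerm → BZTerm
  | bc : BZTerm → BZTerm

/-- The value of a term under an assignment of its variables. -/
def BZTerm.eval {α : Type*} [BZLattice α] (v : ℕ → α) : BZTerm → α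
  | var n => v n
  | inf s t => s.eval v ⊓ t.eval v
  | sup s t => s.eval v ⊔ t.eval v
  | kc t => BZLattice.kc (t.eval v)
  | bc t => BZLattice.bc (t.eval v)

theorem BZHom.map_eval {α β : Type*} [BZLattice α] [BZLattice β] (f : BZHom α β) (v : ℕ → α)
    (t : BZTerm) : f.toFun (t.eval v) = t.eval fun n => f.toFun (v n) := by
  induction t with
  | var n => rfl
  | inf s t hs ht => simp only [BZTerm.eval, f.map_inf, hs, ht]
  | sup s t hs ht => simp only [BZTerm.eval, f.map_sup, hs, ht]
  | kc t ht => simp only [BZTerm.eval, f.map_kc, ht]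
  | bc t ht => simp only [BZTerm.eval, f.map_bc, ht]

/-- The BZ-lattices that satisfy the identity `s ≈ t`. -/
def models (s t : BZTerm) : Set BZLat.{u} := {A | ∀ v : ℕ → A, s.eval v = t.eval v}

theorem isVariety_models (s t : BZTerm) : IsVariety (models.{u} s t) where
  classH_subset := by
    rintro A ⟨B, hB, f, hf⟩ v
    choose w hw using fun n => hf (v n)
    obtain rfl := funext hw
    rw [← f.map_eval, ← f.map_eval, hB w]
  classS_subset := by
    rintro A ⟨B, hB, f, hf⟩ v
    apply hf
    rw [f.map_eval, f.map_eval, hB]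
  classP_subset := by
    rintro _ ⟨ι, F, hF, rfl⟩ v
    funext i
    exact ((BZHom.proj (fun i => F i) i).map_eval v s).trans
      ((hF i _).trans ((BZHom.proj (fun i => F i) i).map_eval v t).symm)

/-- The assignment of `a` and `b` to the first two variables. -/
def assign {α : Type*} (a b : α) : ℕ → α
  | 0 => a
  | _ => b

open BZTerm

/-- Replacing `b` by `a ⊔ b` removes the hypothesis `a ≤ b` from the orthomodular law. -/
theorem OML_eq_models : OML.{u} =
    models (sup (inf (sup (var 0) (var 1)) (kc (var 0))) (var 0)) (sup (var 0) (var 1)) ∩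
      models (bc (var 0)) (kc (var 0)) := by
  ext A
  constructor
  · rintro ⟨h₁, h₂⟩
    exact ⟨fun v => (h₁ _ _ le_sup_left).symm, fun v => h₂ _⟩
  · rintro ⟨h₁, h₂⟩
    refine ⟨fun a b hab => ?_, fun a => h₂ fun _ => a⟩
    have h := h₁ (assign a b)
    simp only [eval, assign, sup_eq_right.2 hab] at h
    exact h.symm

theorem PBZLStar_eq_models : PBZLStar.{u} =
    models (bc (bc (var 0))) (sup (inf (bc (bc (var 0))) (bc (bc (var 1))))
        (inf (bc (bc (var 0))) (bc (inf (bc (bc (var 0))) (bc (bc (var 1))))))) ∩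
      models (bc (inf (var 0) (kc (var 0)))) (sup (bc (var 0)) (bc (kc (var 0)))) := by
  ext A
  constructor
  · rintro ⟨h₁, h₂⟩
    exact ⟨fun v => closedOrthomodular_of_paraorthomodular h₁ _ _, fun v => h₂ _⟩
  · rintro ⟨h₁, h₂⟩
    have h₂' : ∀ x : A, _ := fun x => h₂ fun _ => x
    exact ⟨paraorthomodular_of_closedOrthomodular (fun x y => h₁ (assign x y)) h₂', h₂'⟩

theorem SDM_eq_models : SDM.{u} =
    PBZLStar ∩ models (bc (inf (var 0) (var 1))) (sup (bc (var 0)) (bc (var 1))) := by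
  ext A
  exact and_congr_right fun _ => ⟨fun h v => h _ _, fun h x y => h (assign x y)⟩

theorem isVariety_OML : IsVariety OML.{u} :=
  OML_eq_models ▸ (isVariety_models _ _).inter (isVariety_models _ _)

theorem isVariety_PBZLStar : IsVariety PBZLStar.{u} :=
  PBZLStar_eq_models ▸ (isVariety_models _ _).inter (isVariety_models _ _)

theorem isVariety_SDM : IsVariety SDM.{u} :=
  SDM_eq_models ▸ isVariety_PBZLStar.inter (isVariety_models _ _)

theorem isVariety_SAOL : IsVariety SAOL.{u} :=
  isVariety_SDM.inter (isVariety_varGen _)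

theorem inf_kc_eq_bot_of_mem_OML {A : BZLat.{u}} (hA : A ∈ OML) (a : A) :
    a ⊓ BZLattice.kc a = ⊥ := by
  rw [← hA.2, inf_bc]

theorem OML_subset_SDM : OML.{u} ⊆ SDM := by
  intro A hA
  have h : ∀ x y : A, BZLattice.bc (x ⊓ y) = BZLattice.bc x ⊔ BZLattice.bc y := fun x y => by
    rw [hA.2, hA.2, hA.2, kc_inf]
  refine ⟨⟨fun a b hab h0 => ?_, fun x => h _ _⟩, h⟩
  have := hA.1 a b hab
  rwa [inf_comm, h0, bot_sup_eq, eq_comm] at this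

/-- The BZ-lattices with `x~~ ∧ (y ∧ y') ≤ x`. -/
def smallUnsharp : Set BZLat.{u} :=
  {A | ∀ x y : A, BZLattice.bc (BZLattice.bc x) ⊓ (y ⊓ BZLattice.kc y) ≤ x}

theorem isVariety_smallUnsharp : IsVariety smallUnsharp.{u} := by
  have h : smallUnsharp.{u} = models
      (sup (inf (bc (bc (var 0))) (inf (var 1) (kc (var 1)))) (var 0)) (var 0) := by
    ext A
    exact ⟨fun h v => sup_eq_right.2 (h _ _), fun h x y => sup_eq_right.1 (h (assign x y))⟩
  exact h ▸ isVariety_models _ _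

theorem OML_subset_smallUnsharp : OML.{u} ⊆ smallUnsharp := fun A hA x y => by
  rw [inf_kc_eq_bot_of_mem_OML hA, inf_bot_eq]
  exact bot_le

end Identities

/-! ### Finite antiortholattices that separate the varieties -/

section Antiortholattices

/-- The antiortholattice chain with five elements. -/
instance instBZLatticeFinFive : BZLattice (Fin 5) where
  toLattice := Fin.instLattice
  toBoundedOrder := Fin.instBoundedOrder
  kc a := a.rev
  bc a := if a = 0 then 4 else 0
  kc_antitone := by decide
  kc_kc := by decide
  inf_kc_le_sup_kc := by decide
  bc_antitone := by decide
  inf_bc := by decide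
  le_bc_bc := by decide
  bc_bc := by decide

/-- The ordinal sum of two squares, as a subset of the product of two chains with three elements. -/
def DoubleSquare : Type := {p : Fin 3 × Fin 3 // p ≠ (0, 2) ∧ p ≠ (2, 0)}

namespace DoubleSquare

/-- The element given by a pair. -/
def ofPair (p : Fin 3 × Fin 3) (h : p ≠ (0, 2) ∧ p ≠ (2, 0)) : DoubleSquare := ⟨p, h⟩

instance instDecidableEq : DecidableEq DoubleSquare :=
  inferInstanceAs (DecidableEq {p : Fin 3 × Fin 3 // p ≠ (0, 2) ∧ p ≠ (2, 0)})

instance instFintype : Fintype DoubleSquare :=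
  inferInstanceAs (Fintype {p : Fin 3 × Fin 3 // p ≠ (0, 2) ∧ p ≠ (2, 0)})

instance instLattice : Lattice DoubleSquare :=
  Subtype.lattice (P := fun p : Fin 3 × Fin 3 => p ≠ (0, 2) ∧ p ≠ (2, 0)) (by decide) (by decide)

instance instDecidableLE : DecidableLE DoubleSquare := fun a b =>
  inferInstanceAs (Decidable (a.1.1 ≤ b.1.1 ∧ a.1.2 ≤ b.1.2))

instance instBoundedOrder : BoundedOrder DoubleSquare where
  top := ofPair (2, 2) (by decide)
  bot := ofPair (0, 0) (by decide)
  le_top := by decide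
  bot_le := by decide

instance instBZLattice : BZLattice DoubleSquare where
  kc a := ofPair (a.1.1.rev, a.1.2.rev) (by revert a; decide)
  bc a := if a = ⊥ then ⊤ else ⊥
  kc_antitone := by decide
  kc_kc := by decide
  inf_kc_le_sup_kc := by decide
  bc_antitone := by decide
  inf_bc := by decide
  le_bc_bc := by decide
  bc_bc := by decide

end DoubleSquare

/-- The conditions that define antiortholattices, for BZ-lattices in any universe. -/
def IsAntiortholattice (α : Type v) [BZLattice α] : Prop :=
  (∀ a b : α, a ≤ b → kc a ⊓ b = ⊥ → a = b) ∧
    (∀ x : α, bc (x ⊓ kc x) = bc x ⊔ bc (kc x)) ∧ ∀ x : α, x ⊔ kc x = ⊤ ↔ x = ⊥ ∨ x = ⊤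

theorem IsAntiortholattice.ulift_mem_AOL {α : Type} [BZLattice α] (h : IsAntiortholattice α) :
    (⟨ULift.{u} α⟩ : BZLat.{u}) ∈ AOL :=
  ⟨⟨fun a b hab h0 => ULift.ext _ _ (h.1 a.down b.down hab (congrArg ULift.down h0)),
    fun x => ULift.ext _ _ (h.2.1 x.down)⟩, Set.ext fun x =>
      (ULift.ext_iff).trans ((h.2.2 x.down).trans (or_congr ULift.ext_iff.symm ULift.ext_iff.symm))⟩

theorem ulift_mem_SAOL {α : Type} [BZLattice α] (h : IsAntiortholattice α)
    (h' : ∀ x y : α, bc (x ⊓ y) = bc x ⊔ bc y) : (⟨ULift.{u} α⟩ : BZLat.{u}) ∈ SAOL :=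
  ⟨⟨h.ulift_mem_AOL.1, fun x y => ULift.ext _ _ (h' x.down y.down)⟩,
    subset_varGen _ h.ulift_mem_AOL⟩

theorem isAntiortholattice_finThree : IsAntiortholattice (Fin 3) := by
  refine ⟨?_, ?_, ?_⟩ <;> decide

theorem isAntiortholattice_finFive : IsAntiortholattice (Fin 5) := by
  refine ⟨?_, ?_, ?_⟩ <;> decide

theorem isAntiortholattice_doubleSquare : IsAntiortholattice DoubleSquare := by
  refine ⟨?_, ?_, ?_⟩ <;> decide

theorem D3_mem_SAOL : D3.{u} ∈ SAOL :=
  ulift_mem_SAOL isAntiortholattice_finThree (by decide)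

theorem D3_mem_smallUnsharp : D3.{u} ∈ smallUnsharp := by
  have h : ∀ x y : Fin 3, bc (bc x) ⊓ (y ⊓ kc y) ≤ x := by decide
  exact fun x y => h x.down y.down

theorem finFive_mem_SAOL : (⟨ULift.{u} (Fin 5)⟩ : BZLat.{u}) ∈ SAOL :=
  ulift_mem_SAOL isAntiortholattice_finFive (by decide)

theorem finFive_not_mem_smallUnsharp : (⟨ULift.{u} (Fin 5)⟩ : BZLat.{u}) ∉ smallUnsharp := by
  intro h
  -- In the chain `1~~ = 4`, and the middle element `2 = 2'` lies strictly above `1`.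
  have h' : ¬ (bc (bc (1 : Fin 5)) ⊓ (2 ⊓ kc 2) ≤ 1) := by decide
  exact h' (h ⟨1⟩ ⟨2⟩)

theorem doubleSquare_not_mem_SDM : (⟨ULift.{u} DoubleSquare⟩ : BZLat.{u}) ∉ SDM := by
  intro h
  -- The atoms `(0, 1)` and `(1, 0)` meet in `⊥`, so the left side is `⊤`, while both have Brouwer
  -- complement `⊥`.
  have h' : ¬ ∀ x y : DoubleSquare, bc (x ⊓ y) = bc x ⊔ bc y := by decide
  exact h' fun x y => congrArg ULift.down (h.2 ⟨x⟩ ⟨y⟩)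

end Antiortholattices

/-! ### The chain of joins -/

theorem varJoin_OML_D3_subset_smallUnsharp :
    varJoin OML.{u} (varGen {D3}) ⊆ smallUnsharp :=
  varGen_subset isVariety_smallUnsharp (Set.union_subset OML_subset_smallUnsharp
    (varGen_subset isVariety_smallUnsharp (Set.singleton_subset_iff.2 D3_mem_smallUnsharp)))

theorem varJoin_OML_SAOL_subset_SDM : varJoin OML.{u} SAOL ⊆ SDM :=
  varGen_subset isVariety_SDM (Set.union_subset OML_subset_SDM Set.inter_subset_left)

theorem varGen_D3_subset_SAOL : varGen {D3.{u}} ⊆ SAOL :=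
  varGen_subset isVariety_SAOL (Set.singleton_subset_iff.2 D3_mem_SAOL)

end PBZ

theorem mainTheorem10 :
    PBZ.varJoin PBZ.OML.{u} PBZ.SAOL = PBZ.subdirectProd PBZ.OML PBZ.SAOL ∧
    PBZ.varJoin PBZ.OML.{u} (PBZ.varGen {PBZ.D3}) =
      PBZ.subdirectProd PBZ.OML (PBZ.varGen {PBZ.D3}) ∧
    PBZ.varJoin PBZ.OML.{u} (PBZ.varGen {PBZ.D3}) ⊂ PBZ.varJoin PBZ.OML PBZ.SAOL ∧
    PBZ.varJoin PBZ.OML.{u} PBZ.SAOL ⊂ PBZ.varJoin PBZ.OML (PBZ.varGen PBZ.AOL) := by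
  refine ⟨PBZ.varJoin_eq_subdirectProd PBZ.isVariety_OML PBZ.isVariety_SAOL,
    PBZ.varJoin_eq_subdirectProd PBZ.isVariety_OML (PBZ.isVariety_varGen _), ?_, ?_⟩
  · refine (Set.ssubset_iff_of_subset (PBZ.varGen_mono
      (Set.union_subset_union_right _ PBZ.varGen_D3_subset_SAOL))).2 ⟨_, PBZ.subset_varGen _
        (Or.inr PBZ.finFive_mem_SAOL), fun h => ?_⟩
    exact PBZ.finFive_not_mem_smallUnsharp (PBZ.varJoin_OML_D3_subset_smallUnsharp h)
  · refine (Set.ssubset_iff_of_subset (PBZ.varGen_mono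
      (Set.union_subset_union_right _ Set.inter_subset_right))).2 ⟨_, PBZ.subset_varGen _
        (Or.inr (PBZ.subset_varGen _ PBZ.isAntiortholattice_doubleSquare.ulift_mem_AOL)),
        fun h => ?_⟩
    exact PBZ.doubleSquare_not_mem_SDM (PBZ.varJoin_OML_SAOL_subset_SDM h)
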